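/- Let $\mathbb T$ be the unit circle group with normalized Lebesgue (Haar) measure $m$, and let $\mu$ be a Borel probability measure on $\mathbb T$. For $1\le p\le\infty$ let $P_\mu$ be the contraction of the (real or complex) space $L_p(m)$ given by $P_\mu f(x)=\int_{\mathbb T} f(xy)\,\mu(dy)$, let $E$ be the operator on $L_p(m)$ that sends $f$ to the constant function $\int_{\mathbb T} f\,dm$, and let $\|\cdot\|_p$ denote the operator norm on $L_p(m)$. Suppose that $\mu$ is adapted, i.e. the closed subgroup of $\mathbb T$ generated by the support of $\mu$ is $\mathbb T$, and that every convolution power $\mu^{n}=\mu*\cdots*\mu$ ($n\ge 1$ factors) is singular with respect to $m$. Then the limits $\lim_{n\to\infty}\|P_\mu^n-E\|_1$ and $\lim_{n\to\infty}\|P_\mu^n-E\|_\infty$ exist and $$\lim_{n\to\infty}\|P_\mu^n-E\|_1>0\qquad\text{and}\qquad \lim_{n\to\infty}\|P_\mu^n-E\|_\infty>0 .$$ -/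

import Mathlib

open MeasureTheory Filter Topology
open scoped ENNReal

namespace CircleConv

/-! ## The circle group as a measure space -/

noncomputable instance : MeasurableSpace Circle := borel Circle

instance : BorelSpace Circle := ⟨rfl⟩

/-- Normalized Lebesgue (Haar) measure on the unit circle. -/
noncomputable def m : Measure Circle := Measure.haarMeasure ⊤

instance : Measure.IsHaarMeasure m := by unfold m; infer_instance

instance : IsProbabilityMeasure m := ⟨Measure.haarMeasure_self⟩

/-! ## Properties of a measure on the circle -/

/-- A measure is adapted if the closed subgroup generated by its support is the whole circle. -/
def IsAdapted (μ : Measure Circle) : Prop :=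
  (Subgroup.closure μ.support).topologicalClosure = ⊤

/-- Convolution powers: `convPow μ 0` is the unit mass at `1`, and
`convPow μ (n + 1) = convPow μ n * μ` (convolution of measures). -/
noncomputable def convPow (μ : Measure Circle) : ℕ → Measure Circle
  | 0 => Measure.dirac 1
  | n + 1 => (convPow μ n).mconv μ

/-! ## The convolution operator on `L_p` -/

/-- The operator on functions: `(P_μ f)(x) = ∫ f(xy) μ(dy)`. -/
noncomputable def convFun {𝕜 : Type*} [RCLike 𝕜] (μ : Measure Circle) (f : Circle → 𝕜) :
    Circle → 𝕜 :=
  fun x ↦ ∫ y, f (x * y) ∂μ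

theorem measurePreserving_mul (μ : Measure Circle) [IsProbabilityMeasure μ] :
    MeasurePreserving (fun z : Circle × Circle ↦ z.1 * z.2) (m.prod μ) m := by
  refine ⟨measurable_mul, ?_⟩
  ext s hs
  rw [Measure.map_apply measurable_mul hs, Measure.prod_apply_symm (measurable_mul hs)]
  have h (y : Circle) :
      m ((fun x : Circle ↦ (x, y)) ⁻¹' ((fun z : Circle × Circle ↦ z.1 * z.2) ⁻¹' s)) = m s :=
    measure_preimage_mul_right m y s
  simp [h]

theorem convFun_congr {𝕜 : Type*} [RCLike 𝕜] (μ : Measure Circle) [IsProbabilityMeasure μ]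
    {f g : Circle → 𝕜} (h : f =ᵐ[m] g) : convFun μ f =ᵐ[m] convFun μ g := by
  have h1 := Measure.ae_ae_of_ae_prod
    ((measurePreserving_mul μ).quasiMeasurePreserving.ae h)
  filter_upwards [h1] with x hx
  exact integral_congr_ae hx

theorem ae_integrable {𝕜 : Type*} [RCLike 𝕜] (μ : Measure Circle) [IsProbabilityMeasure μ]
    {f : Circle → 𝕜} (hf : Integrable f m) :
    ∀ᵐ x ∂m, Integrable (fun y ↦ f (x * y)) μ :=
  ((measurePreserving_mul μ).integrable_comp_of_integrable hf).prod_right_ae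

theorem aestronglyMeasurable_convFun {𝕜 : Type*} [RCLike 𝕜] (μ : Measure Circle)
    [IsProbabilityMeasure μ] {f : Circle → 𝕜} (hf : AEStronglyMeasurable f m) :
    AEStronglyMeasurable (convFun μ f) m :=
  (hf.comp_measurePreserving (measurePreserving_mul μ)).integral_prod_right'

theorem eLpNorm_convFun_le {𝕜 : Type*} [RCLike 𝕜] (μ : Measure Circle) [IsProbabilityMeasure μ]
    {p : ℝ≥0∞} (hp : 1 ≤ p) {f : Circle → 𝕜} (hf : AEStronglyMeasurable f m) :
    eLpNorm (convFun μ f) p m ≤ eLpNorm f p m := by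
  have hF := hf.comp_measurePreserving (measurePreserving_mul μ)
  rcases eq_or_ne p ∞ with rfl | hp'
  · rw [eLpNorm_exponent_top, eLpNorm_exponent_top]
    have h1 := Measure.ae_ae_of_ae_prod
      ((measurePreserving_mul μ).quasiMeasurePreserving.ae (ae_le_eLpNormEssSup (f := f) (μ := m)))
    refine eLpNormEssSup_le_of_ae_enorm_bound ?_
    filter_upwards [h1] with x hx
    calc ‖convFun μ f x‖ₑ ≤ ∫⁻ y, ‖f (x * y)‖ₑ ∂μ := enorm_integral_le_lintegral_enorm _
      _ ≤ ∫⁻ _, eLpNormEssSup f m ∂μ := lintegral_mono_ae hx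
      _ = eLpNormEssSup f m := by simp
  · have hp0 : p ≠ 0 := (zero_lt_one.trans_le hp).ne'
    have hr : 0 < p.toReal := ENNReal.toReal_pos hp0 hp'
    rw [eLpNorm_eq_lintegral_rpow_enorm_toReal hp0 hp',
      eLpNorm_eq_lintegral_rpow_enorm_toReal hp0 hp']
    refine ENNReal.rpow_le_rpow ?_ (by positivity)
    calc ∫⁻ x, ‖convFun μ f x‖ₑ ^ p.toReal ∂m
        ≤ ∫⁻ x, ∫⁻ y, ‖f (x * y)‖ₑ ^ p.toReal ∂μ ∂m := by
          refine lintegral_mono_ae ?_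
          filter_upwards [hF.prodMk_left] with x hx
          have h2 : ‖convFun μ f x‖ₑ ≤ eLpNorm (fun y ↦ f (x * y)) p μ := by
            refine le_trans ?_ (eLpNorm_le_eLpNorm_of_exponent_le hp hx)
            rw [eLpNorm_one_eq_lintegral_enorm]
            exact enorm_integral_le_lintegral_enorm _
          rw [eLpNorm_eq_lintegral_rpow_enorm_toReal hp0 hp'] at h2
          calc _ ≤ _ := ENNReal.rpow_le_rpow h2 hr.le
            _ = _ := by
              rw [← ENNReal.rpow_mul, one_div, inv_mul_cancel₀ hr.ne', ENNReal.rpow_one]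
      _ = ∫⁻ z, ‖f (z.1 * z.2)‖ₑ ^ p.toReal ∂(m.prod μ) :=
          (lintegral_prod (fun z : Circle × Circle ↦ ‖f (z.1 * z.2)‖ₑ ^ p.toReal)
            (hF.enorm.pow_const _)).symm
      _ = ∫⁻ x, ‖f x‖ₑ ^ p.toReal ∂m := by
          conv_rhs => rw [← (measurePreserving_mul μ).map_eq]
          rw [lintegral_map' _ measurable_mul.aemeasurable]
          rw [(measurePreserving_mul μ).map_eq]
          exact hf.enorm.pow_const _

theorem memLp_convFun {𝕜 : Type*} [RCLike 𝕜] (μ : Measure Circle) [IsProbabilityMeasure μ]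
    {p : ℝ≥0∞} (hp : 1 ≤ p) {f : Circle → 𝕜} (hf : MemLp f p m) : MemLp (convFun μ f) p m :=
  ⟨aestronglyMeasurable_convFun μ hf.1, (eLpNorm_convFun_le μ hp hf.1).trans_lt hf.2⟩

/-- The Markov operator `P_μ f(x) = ∫ f(xy) μ(dy)` as a bounded operator of `L_p(m)`. -/
noncomputable def convOp (𝕜 : Type*) [RCLike 𝕜] (μ : Measure Circle) [IsProbabilityMeasure μ]
    (p : ℝ≥0∞) [hp : Fact (1 ≤ p)] : Lp 𝕜 p m →L[𝕜] Lp 𝕜 p m :=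
  LinearMap.mkContinuous
    { toFun := fun f ↦ (memLp_convFun μ hp.out (Lp.memLp f)).toLp (convFun μ f)
      map_add' := fun f g ↦ by
        rw [← MemLp.toLp_add]
        refine MemLp.toLp_congr _ _ ((convFun_congr μ (Lp.coeFn_add f g)).trans ?_)
        filter_upwards [ae_integrable μ ((Lp.memLp f).integrable hp.out),
          ae_integrable μ ((Lp.memLp g).integrable hp.out)] with x hf hg
        exact integral_add hf hg
      map_smul' := fun c f ↦ by
        rw [RingHom.id_apply, ← MemLp.toLp_const_smul]
        refine MemLp.toLp_congr _ _ ((convFun_congr μ (Lp.coeFn_smul c f)).trans ?_)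
        exact Eventually.of_forall fun x ↦ integral_smul c _ }
    1 (fun f ↦ by
      change ‖(memLp_convFun μ hp.out (Lp.memLp f)).toLp (convFun μ f)‖ ≤ _
      rw [Lp.norm_toLp, one_mul, Lp.norm_def]
      exact ENNReal.toReal_mono (Lp.eLpNorm_ne_top f) (eLpNorm_convFun_le μ hp.out (Lp.memLp f).1))

theorem coeFn_convOp {𝕜 : Type*} [RCLike 𝕜] (μ : Measure Circle) [IsProbabilityMeasure μ]
    (p : ℝ≥0∞) [Fact (1 ≤ p)] (f : Lp 𝕜 p m) :
    convOp 𝕜 μ p f =ᵐ[m] fun x ↦ ∫ y, f (x * y) ∂μ :=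
  MemLp.coeFn_toLp (memLp_convFun μ Fact.out (Lp.memLp f))

/-! ## The expectation operator on `L_p` -/

/-- The expectation `E f = ∫ f dm`, viewed as the operator of `L_p(m)` that sends `f` to the
constant function with value `∫ f dm`. -/
noncomputable def expOp (𝕜 : Type*) [RCLike 𝕜] (p : ℝ≥0∞) [hp : Fact (1 ≤ p)] :
    Lp 𝕜 p m →L[𝕜] Lp 𝕜 p m :=
  LinearMap.mkContinuous
    { toFun := fun f ↦ Lp.const p m (∫ x, f x ∂m)
      map_add' := fun f g ↦ by
        rw [integral_congr_ae (Lp.coeFn_add f g), ← map_add]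
        congr 1
        exact integral_add ((Lp.memLp f).integrable hp.out) ((Lp.memLp g).integrable hp.out)
      map_smul' := fun c f ↦ by
        rw [integral_congr_ae (Lp.coeFn_smul c f)]
        have h : ∫ x, (c • (f : Circle → 𝕜)) x ∂m = c • ∫ x, f x ∂m := integral_smul c _
        rw [h]
        rfl }
    1 (fun f ↦ by
      change ‖Lp.const p m (∫ x, f x ∂m)‖ ≤ _
      refine (Lp.norm_const_le _ _ _).trans ?_
      rw [one_mul, probReal_univ, Real.one_rpow, mul_one, Lp.norm_def, ← toReal_enorm]
      refine ENNReal.toReal_mono (Lp.eLpNorm_ne_top f) ?_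
      refine le_trans ?_ (eLpNorm_le_eLpNorm_of_exponent_le hp.out (Lp.memLp f).1)
      rw [eLpNorm_one_eq_lintegral_enorm]
      exact enorm_integral_le_lintegral_enorm _)

theorem coeFn_expOp {𝕜 : Type*} [RCLike 𝕜] (p : ℝ≥0∞) [Fact (1 ≤ p)] (f : Lp 𝕜 p m) :
    expOp 𝕜 p f =ᵐ[m] fun _ ↦ ∫ x, f x ∂m :=
  Lp.coeFn_const _ _ _

end CircleConv

/-!
Left multiplication by `P_μ` fixes `E` and does not increase norms, so `‖P_μ ^ n - E‖` is
nonincreasing in `n` and has a limit; only its positivity uses the singularity of the powers of `μ`.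

Since `P_μ ^ n = P_ν` with `ν = μ ^ n`, it suffices to bound `‖P_ν - E‖` below for every probability
measure `ν` singular with respect to `m`. Such a `ν` charges a compact set `K` with mass more than
`3 / 4` that has an open neighbourhood `U` with `m U < 1 / 4`, and by compactness `V * K ⊆ U` for
some neighbourhood `V` of `1`. Testing `(P_ν - E) 1_A` against `1_S` gives
`(m × ν) {(x, y) | x ∈ S, x y ∈ A} - m S * m A` (`setIntegral_convOp_sub_expOp_indicator`).
For `S = V`, `A = U` the set contains `V × K`, and the pairing is at least `m V / 2` while the two
indicators have norms `m V` in `L_1` and `1` in `L_∞`: this bounds the norm on `L_∞`.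
The dual choice `S = U⁻¹`, `A = V⁻¹` bounds the norm on `L_1`.
-/

namespace CircleConv

open scoped Pointwise

/-! ### Powers of the operator -/

instance isProbabilityMeasure_convPow (μ : Measure Circle) [IsProbabilityMeasure μ] (n : ℕ) :
    IsProbabilityMeasure (convPow μ n) := by
  induction n with
  | zero => exact inferInstanceAs (IsProbabilityMeasure (Measure.dirac 1))
  | succ n ih => exact inferInstanceAs (IsProbabilityMeasure ((convPow μ n).mconv μ))

theorem convOp_mconv (𝕜 : Type*) [RCLike 𝕜] (μ ν : Measure Circle) [IsProbabilityMeasure μ]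
    [IsProbabilityMeasure ν] (p : ℝ≥0∞) [hp : Fact (1 ≤ p)] :
    convOp 𝕜 (μ.mconv ν) p = convOp 𝕜 μ p * convOp 𝕜 ν p := by
  ext1 f
  refine Lp.ext ?_
  have hcomp : convFun μ (convOp 𝕜 ν p f) =ᵐ[m] convFun μ (convFun ν f) :=
    convFun_congr μ (coeFn_convOp ν p f)
  filter_upwards [coeFn_convOp (μ.mconv ν) p f, coeFn_convOp μ p (convOp 𝕜 ν p f), hcomp,
    ae_integrable (μ.mconv ν) ((Lp.memLp f).integrable hp.out)] with x h₁ h₂ h₃ hint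
  rw [h₁, mul_apply_eq_comp, h₂]
  refine Eq.trans ?_ h₃.symm
  simp only [convFun]
  rw [MeasureTheory.integral_mconv hint]
  simp only [mul_assoc]

theorem convOp_dirac_one (𝕜 : Type*) [RCLike 𝕜] (p : ℝ≥0∞) [Fact (1 ≤ p)] :
    convOp 𝕜 (Measure.dirac 1) p = 1 := by
  ext1 f
  refine Lp.ext ?_
  filter_upwards [coeFn_convOp (Measure.dirac 1) p f] with x hx
  rw [hx]
  simp

theorem convOp_convPow (𝕜 : Type*) [RCLike 𝕜] (μ : Measure Circle) [IsProbabilityMeasure μ]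
    (p : ℝ≥0∞) [Fact (1 ≤ p)] (n : ℕ) : convOp 𝕜 (convPow μ n) p = convOp 𝕜 μ p ^ n := by
  induction n with
  | zero => exact convOp_dirac_one 𝕜 p
  | succ n ih =>
    rw [pow_succ, ← ih]
    exact convOp_mconv 𝕜 (convPow μ n) μ p

theorem norm_convOp_le (𝕜 : Type*) [RCLike 𝕜] (μ : Measure Circle) [IsProbabilityMeasure μ]
    (p : ℝ≥0∞) [Fact (1 ≤ p)] : ‖convOp 𝕜 μ p‖ ≤ 1 :=
  LinearMap.mkContinuous_norm_le _ zero_le_one _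

theorem convOp_mul_expOp (𝕜 : Type*) [RCLike 𝕜] (μ : Measure Circle) [IsProbabilityMeasure μ]
    (p : ℝ≥0∞) [Fact (1 ≤ p)] : convOp 𝕜 μ p * expOp 𝕜 p = expOp 𝕜 p := by
  ext1 f
  refine Lp.ext ?_
  have hcongr : convFun μ (expOp 𝕜 p f) =ᵐ[m] convFun μ fun _ ↦ ∫ x, f x ∂m :=
    convFun_congr μ (coeFn_expOp p f)
  filter_upwards [coeFn_convOp μ p (expOp 𝕜 p f), hcongr, coeFn_expOp p f] with x h₁ h₂ h₃
  rw [mul_apply_eq_comp, h₁, h₃]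
  exact h₂.trans (by simp [convFun])

theorem antitone_norm_convOp_pow_sub_expOp (𝕜 : Type*) [RCLike 𝕜] (μ : Measure Circle)
    [IsProbabilityMeasure μ] (p : ℝ≥0∞) [Fact (1 ≤ p)] :
    Antitone fun n : ℕ ↦ ‖convOp 𝕜 μ p ^ n - expOp 𝕜 p‖ := by
  refine antitone_nat_of_succ_le fun n ↦ ?_
  have h : convOp 𝕜 μ p ^ (n + 1) - expOp 𝕜 p =
      convOp 𝕜 μ p * (convOp 𝕜 μ p ^ n - expOp 𝕜 p) := by
    rw [mul_sub, convOp_mul_expOp, pow_succ']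
  rw [h]
  exact (norm_mul_le _ _).trans (mul_le_of_le_one_left (norm_nonneg _) (norm_convOp_le 𝕜 μ p))

/-! ### Pairing with indicator functions -/

theorem setIntegral_convOp_sub_expOp_indicator (𝕜 : Type*) [RCLike 𝕜] (ν : Measure Circle)
    [IsProbabilityMeasure ν] (p : ℝ≥0∞) [hp : Fact (1 ≤ p)] (S : Set Circle) {A : Set Circle}
    (hA : MeasurableSet A) :
    ∫ x in S, (convOp 𝕜 ν p - expOp 𝕜 p)
        (indicatorConstLp p hA (measure_ne_top m A) (1 : 𝕜)) x ∂m =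
      (((m.prod ν).real {z | z.1 ∈ S ∧ z.1 * z.2 ∈ A} - m.real S * m.real A : ℝ) : 𝕜) := by
  set f : Lp 𝕜 p m := indicatorConstLp p hA (measure_ne_top m A) (1 : 𝕜) with hf
  have hfA : f =ᵐ[m] A.indicator fun _ ↦ (1 : 𝕜) := indicatorConstLp_coeFn
  have hB : MeasurableSet {z : Circle × Circle | z.1 * z.2 ∈ A} := measurable_mul hA
  have hQ : (m.prod ν).real {z | z.1 ∈ S ∧ z.1 * z.2 ∈ A} =
      ((m.restrict S).prod ν).real {z | z.1 * z.2 ∈ A} := by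
    have hprod : (m.restrict S).prod ν = (m.prod ν).restrict (S ×ˢ Set.univ) := by
      rw [← Measure.prod_restrict, Measure.restrict_univ]
    rw [hprod, measureReal_restrict_apply hB]
    congr 1
    ext z
    simp [and_comm]
  have hP : ∫ x in S, convOp 𝕜 ν p f x ∂m =
      (((m.prod ν).real {z | z.1 ∈ S ∧ z.1 * z.2 ∈ A} : ℝ) : 𝕜) := by
    have h : convOp 𝕜 ν p f =ᵐ[m] convFun ν (A.indicator fun _ ↦ (1 : 𝕜)) :=
      (coeFn_convOp ν p f).trans (convFun_congr ν hfA)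
    rw [integral_congr_ae (ae_restrict_of_ae h), hQ]
    have hint : Integrable ({z : Circle × Circle | z.1 * z.2 ∈ A}.indicator fun _ ↦ (1 : 𝕜))
        ((m.restrict S).prod ν) := (integrable_const _).indicator hB
    refine (integral_prod _ hint).symm.trans ?_
    rw [integral_indicator_const _ hB, RCLike.real_smul_eq_coe_mul, mul_one]
  have hE : ∫ x in S, expOp 𝕜 p f x ∂m = ((m.real S * m.real A : ℝ) : 𝕜) := by
    rw [integral_congr_ae (ae_restrict_of_ae (coeFn_expOp p f)), integral_congr_ae hfA,
      integral_indicator_const _ hA, setIntegral_const]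
    simp [RCLike.real_smul_eq_coe_mul]
  have hsub : (convOp 𝕜 ν p - expOp 𝕜 p) f =ᵐ[m]
      fun x ↦ convOp 𝕜 ν p f x - expOp 𝕜 p f x := Lp.coeFn_sub _ _
  rw [integral_congr_ae (ae_restrict_of_ae hsub), integral_sub, hP, hE, RCLike.ofReal_sub]
  · exact ((Lp.memLp _).integrable hp.out).restrict
  · exact ((Lp.memLp _).integrable hp.out).restrict

theorem abs_pairing_le_norm_one_mul (𝕜 : Type*) [RCLike 𝕜] (ν : Measure Circle)
    [IsProbabilityMeasure ν] (S : Set Circle) {A : Set Circle} (hA : MeasurableSet A) :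
    |(m.prod ν).real {z | z.1 ∈ S ∧ z.1 * z.2 ∈ A} - m.real S * m.real A| ≤
      ‖convOp 𝕜 ν 1 - expOp 𝕜 1‖ * m.real A := by
  rw [← RCLike.norm_ofReal (K := 𝕜), ← setIntegral_convOp_sub_expOp_indicator 𝕜 ν 1 S hA]
  set f : Lp 𝕜 1 m := indicatorConstLp 1 hA (measure_ne_top m A) (1 : 𝕜) with hf
  have hfn : ‖f‖ = m.real A := by
    rw [hf, norm_indicatorConstLp one_ne_zero ENNReal.one_ne_top]; simp
  rw [← hfn]
  refine le_trans ?_ (ContinuousLinearMap.le_opNorm _ f)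
  rw [L1.norm_eq_integral_norm]
  exact (norm_integral_le_integral_norm _).trans
    (setIntegral_le_integral (L1.integrable_coeFn _).norm
      (Eventually.of_forall fun _ ↦ norm_nonneg _))

theorem ae_norm_le_norm_top {𝕜 : Type*} [RCLike 𝕜] (f : Lp 𝕜 ∞ m) : ∀ᵐ x ∂m, ‖f x‖ ≤ ‖f‖ := by
  filter_upwards [ae_le_eLpNormEssSup (f := f) (μ := m)] with x hx
  rw [← eLpNorm_exponent_top] at hx
  rw [Lp.norm_def, ← toReal_enorm]
  exact ENNReal.toReal_mono (Lp.eLpNorm_ne_top f) hx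

theorem abs_pairing_le_norm_top_mul (𝕜 : Type*) [RCLike 𝕜] (ν : Measure Circle)
    [IsProbabilityMeasure ν] (S : Set Circle) {A : Set Circle} (hA : MeasurableSet A) :
    |(m.prod ν).real {z | z.1 ∈ S ∧ z.1 * z.2 ∈ A} - m.real S * m.real A| ≤
      ‖convOp 𝕜 ν ∞ - expOp 𝕜 ∞‖ * m.real S := by
  rw [← RCLike.norm_ofReal (K := 𝕜), ← setIntegral_convOp_sub_expOp_indicator 𝕜 ν ∞ S hA]
  set f : Lp 𝕜 ∞ m := indicatorConstLp ∞ hA (measure_ne_top m A) (1 : 𝕜) with hf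
  have hfn : ‖f‖ ≤ 1 := by
    refine norm_indicatorConstLp_le.trans ?_
    simp
  refine norm_setIntegral_le_of_norm_le_const_ae' (measure_lt_top m S) ?_
  filter_upwards [ae_norm_le_norm_top ((convOp 𝕜 ν ∞ - expOp 𝕜 ∞) f)] with x hx _
  exact hx.trans ((ContinuousLinearMap.le_opNorm _ f).trans
    (mul_le_of_le_one_right (norm_nonneg _) hfn))

/-! ### Singular measures -/

/-- The test sets for a singular measure: `K` nearly carries `ν`, and the translates of `K` by `V`
stay inside the small set `U`. -/
theorem exists_mul_subset_of_mutuallySingular {ν : Measure Circle} [IsProbabilityMeasure ν]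
    (h : ν ⟂ₘ m) : ∃ V K U : Set Circle, IsOpen V ∧ IsCompact K ∧ IsOpen U ∧ V * K ⊆ U ∧
      0 < m.real V ∧ 3 / 4 < ν.real K ∧ m.real U < 1 / 4 := by
  obtain ⟨s, hs, hνs, hms⟩ := h
  have hνsc : ν sᶜ = 1 := (prob_compl_eq_one_iff hs).2 hνs
  obtain ⟨K, hKs, hK, hνK⟩ := hs.compl.exists_lt_isCompact (μ := ν)
    (r := ENNReal.ofReal (3 / 4)) (by rw [hνsc, ENNReal.ofReal_lt_one]; norm_num)
  have hmK : m K = 0 := measure_mono_null hKs hms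
  obtain ⟨U, hKU, hU, hmU⟩ := K.exists_isOpen_lt_of_lt (μ := m) (ENNReal.ofReal (1 / 4))
    (by rw [hmK, ENNReal.ofReal_pos]; norm_num)
  obtain ⟨W, hW, hWK⟩ := compact_open_separated_mul_left hK hU hKU
  obtain ⟨V, hVW, hV, h1V⟩ := mem_nhds_iff.1 hW
  refine ⟨V, K, U, hV, hK, hU, (Set.mul_subset_mul_right hVW).trans hWK, ?_, ?_, ?_⟩
  · exact ENNReal.toReal_pos (hV.measure_pos m ⟨1, h1V⟩).ne' (measure_ne_top m V)
  · exact (ENNReal.ofReal_lt_iff_lt_toReal (by norm_num) (measure_ne_top ν K)).1 hνK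
  · exact (ENNReal.lt_ofReal_iff_toReal_lt (measure_ne_top m U)).1 hmU

theorem half_le_norm_convOp_sub_expOp_top (𝕜 : Type*) [RCLike 𝕜] {ν : Measure Circle}
    [IsProbabilityMeasure ν] (h : ν ⟂ₘ m) : 1 / 2 ≤ ‖convOp 𝕜 ν ∞ - expOp 𝕜 ∞‖ := by
  obtain ⟨V, K, U, hV, hK, hU, hVK, hmV, hνK, hmU⟩ := exists_mul_subset_of_mutuallySingular h
  have hle := (le_abs_self _).trans
    (abs_pairing_le_norm_top_mul 𝕜 ν V hU.measurableSet)
  have hmono : m.real V * ν.real K ≤ (m.prod ν).real {z | z.1 ∈ V ∧ z.1 * z.2 ∈ U} := by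
    rw [← measureReal_prod_prod]
    exact measureReal_mono fun z hz ↦ ⟨hz.1, hVK (Set.mul_mem_mul hz.1 hz.2)⟩
  refine le_of_mul_le_mul_right ?_ hmV
  nlinarith

theorem half_le_norm_convOp_sub_expOp_one (𝕜 : Type*) [RCLike 𝕜] {ν : Measure Circle}
    [IsProbabilityMeasure ν] (h : ν ⟂ₘ m) : 1 / 2 ≤ ‖convOp 𝕜 ν 1 - expOp 𝕜 1‖ := by
  obtain ⟨V, K, U, hV, hK, hU, hVK, hmV, hνK, hmU⟩ := exists_mul_subset_of_mutuallySingular h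
  have hle := (le_abs_self _).trans
    (abs_pairing_le_norm_one_mul 𝕜 ν U⁻¹ hV.inv.measurableSet)
  have hV' : m.real V⁻¹ = m.real V := by simp [measureReal_def]
  have hU' : m.real U⁻¹ = m.real U := by simp [measureReal_def]
  rw [hV', hU'] at hle
  -- The shear `(x, y) ↦ (x * y, y)` turns the smaller set `{x * y ∈ V⁻¹, y ∈ K}` into `V⁻¹ ×ˢ K`.
  have hshear : (m.prod ν) {z | z.1 * z.2 ∈ V⁻¹ ∧ z.2 ∈ K} = m V⁻¹ * ν K := by
    have hmeas : MeasurableSet {z : Circle × Circle | z.1 * z.2 ∈ V⁻¹ ∧ z.2 ∈ K} :=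
      (measurable_mul hV.inv.measurableSet).inter (measurable_snd hK.measurableSet)
    rw [Measure.prod_apply_symm hmeas, ← lintegral_indicator_const hK.measurableSet]
    refine lintegral_congr fun y ↦ ?_
    by_cases hy : y ∈ K
    · rw [Set.indicator_of_mem hy, ← measure_preimage_mul_right m y V⁻¹]
      congr 1
      ext x
      simp [hy]
    · simp [hy]
  have hmono : m.real V * ν.real K ≤ (m.prod ν).real {z | z.1 ∈ U⁻¹ ∧ z.1 * z.2 ∈ V⁻¹} := by
    rw [← hV', measureReal_def, measureReal_def, ← ENNReal.toReal_mul, ← hshear]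
    refine measureReal_mono fun z hz ↦ ⟨hVK ?_, hz.1⟩
    have hmem : (z.1 * z.2)⁻¹ * z.2 ∈ V * K := Set.mul_mem_mul hz.1 hz.2
    simpa [mul_inv] using hmem
  refine le_of_mul_le_mul_right ?_ hmV
  nlinarith

theorem exists_pos_tendsto_norm_convOp_pow_sub_expOp (𝕜 : Type*) [RCLike 𝕜] (μ : Measure Circle)
    [IsProbabilityMeasure μ] (p : ℝ≥0∞) [Fact (1 ≤ p)]
    (h : ∀ n : ℕ, 1 ≤ n → 1 / 2 ≤ ‖convOp 𝕜 (convPow μ n) p - expOp 𝕜 p‖) :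
    ∃ c : ℝ, 0 < c ∧ Tendsto (fun n : ℕ ↦ ‖convOp 𝕜 μ p ^ n - expOp 𝕜 p‖) atTop (𝓝 c) := by
  have hlim := tendsto_atTop_ciInf (antitone_norm_convOp_pow_sub_expOp 𝕜 μ p)
    ⟨0, Set.forall_mem_range.2 fun _ ↦ norm_nonneg _⟩
  refine ⟨_, lt_of_lt_of_le one_half_pos (ge_of_tendsto hlim ?_), hlim⟩
  filter_upwards [eventually_ge_atTop 1] with n hn
  rw [← convOp_convPow]
  exact h n hn

end CircleConv

theorem mainTheorem3 {𝕜 : Type*} [RCLike 𝕜] (μ : Measure Circle) [IsProbabilityMeasure μ]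
    (hμ : CircleConv.IsAdapted μ)
    (hsing : ∀ n : ℕ, 1 ≤ n → CircleConv.convPow μ n ⟂ₘ CircleConv.m) :
    (∃ c : ℝ, 0 < c ∧
      Tendsto (fun n : ℕ ↦ ‖CircleConv.convOp 𝕜 μ 1 ^ n - CircleConv.expOp 𝕜 1‖) atTop (𝓝 c)) ∧
    (∃ c : ℝ, 0 < c ∧
      Tendsto (fun n : ℕ ↦ ‖CircleConv.convOp 𝕜 μ ∞ ^ n - CircleConv.expOp 𝕜 ∞‖) atTop (𝓝 c)) :=
  ⟨CircleConv.exists_pos_tendsto_norm_convOp_pow_sub_expOp 𝕜 μ 1 fun n hn ↦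
      CircleConv.half_le_norm_convOp_sub_expOp_one 𝕜 (hsing n hn),
    CircleConv.exists_pos_tendsto_norm_convOp_pow_sub_expOp 𝕜 μ ∞ fun n hn ↦
      CircleConv.half_le_norm_convOp_sub_expOp_top 𝕜 (hsing n hn)⟩
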